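/- **Model.** Fix an integer $p\ge 2$. An input is a simple undirected graph on the vertex set $[n]$ given by an adjacency list representation, i.e. with an ordering of the neighbours of each vertex; $S_p=\sum_v\binom{\deg v}{p}$ is its number of $p$-stars, where $\binom{x}{p}=0$ if $x<p$. A randomized algorithm (a deterministic adaptive algorithm that depends on a random seed independent of the oracle; it may depend on $n$ and on all parameters below) accesses the input through neighbour queries (given $v,i$, return the $i$-th neighbour of $v$, or $\bot$ if $i>\deg v$), degree queries (given $v$, return $\deg v$) and random edge queries (return a uniformly random edge, independently each time; $\bot$ if there are no edges), and outputs a real number. **Parameters.** For $k\in\mathbb N$ let $n_1,d_1,n_2,d_2$ be positive integers (depending on $k$) such that $d_1$ and $n_2$ are even, $n_2\le d_1\le 2d_2$ and $d_1+2d_2<n_1$. Put $$n=n_1+n_2,\qquad r=\frac{(d_1+d_2)\,n_2}{d_1n_1},\qquad s_1=n_1\binom{d_1}{p},\qquad s_2=n_1\binom{d_1}{p}+n_2\binom{d_2}{p}.$$ Let $f(n,p)>0$ be such that $s_1=\Theta(f(n,p))$ as $k\to\infty$, and suppose that $s_2\ge c\,s_1$ for all $k$, for some constant $c>1$. **Claim.**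 Approximating $S_p$ to a multiplicative factor with probability at least $2/3$ on inputs with $S_p=\Theta(f(n,p))$ requires $\Omega(1/r)$ queries, and hence $\Omega(q)$ queries for every $q=o(1/r)$. Precisely, there are constants $0<A\le B$ such that the following holds for any algorithm which, on every input on $n$ vertices with $A f(n,p)\le S_p\le B f(n,p)$, makes at most $T$ queries in total and with probability at least $2/3$ outputs a value in $[aS_p,\,bS_p]$, where $a>0$ and $b<c\,a$ (for example $a=1/\alpha$, $b=\alpha$ with $1\le\alpha<\sqrt c$, or $a=1-\epsilon$, $b=1+\epsilon$ with $0\le\epsilon<1$ and $1+\epsilon<c(1-\epsilon)$): 1. there is a constant $\kappa>0$, independent of the algorithm, of $a,b$ and of $k$, such that $T\ge\kappa/r$ for all sufficiently large $k$; 2. for every $q=q(k)$ with $q=o(1/r)$ as $k\to\infty$, $T\ge q$ for all sufficiently large $k$ (how large does not depend on the algorithm or on $a,b$). -/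

import Mathlib

open Filter Asymptotics MeasureTheory
open scoped ENNReal Topology

namespace StarCounting

/-- The input of an algorithm: a simple undirected graph on `n` labelled vertices, given by an
adjacency list representation, that is, for every vertex a list of its neighbours in some order. -/
structure GraphInput (n : ℕ) where
  graph : SimpleGraph (Fin n)
  adj : Fin n → List (Fin n)
  nodup_adj : ∀ v, (adj v).Nodup
  mem_adj : ∀ v w, w ∈ adj v ↔ graph.Adj v w

/-- A deterministic algorithm for graphs on `n` vertices, as an adaptive decision tree: it either
stops with a real output, or asks the oracle a query and continues according to the answer. -/
inductive QueryAlg (n : ℕ) : Type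
  /-- Stop and output `s`. -/
  | output (s : ℝ) : QueryAlg n
  /-- Ask for the degree of `v`. -/
  | degree (v : Fin n) (next : ℕ → QueryAlg n) : QueryAlg n
  /-- Ask for the neighbour of `v` at position `i` (counted from `0`) of its adjacency list;
  the answer is `none` if there is none. -/
  | neighbor (v : Fin n) (i : ℕ) (next : Option (Fin n) → QueryAlg n) : QueryAlg n
  /-- Ask for a uniformly random edge; the answer is `none` if the graph has no edge. -/
  | randomEdge (next : Option (Sym2 (Fin n)) → QueryAlg n) : QueryAlg n

namespace GraphInput

variable {n : ℕ}

open Classical in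
/-- The degree of a vertex. -/
noncomputable def deg (I : GraphInput n) (v : Fin n) : ℕ := I.graph.degree v

/-- `S_p`, the number of `p`-stars: a star is a centre `v` together with `p` neighbours of `v`. -/
noncomputable def starCount (I : GraphInput n) (p : ℕ) : ℕ := ∑ v, (I.deg v).choose p

open Classical in
/-- The possible answers to a random edge query. -/
noncomputable def edgeAnswers (I : GraphInput n) : Finset (Option (Sym2 (Fin n))) :=
  if I.graph.edgeFinset.Nonempty then I.graph.edgeFinset.image some else {none}

theorem edgeAnswers_nonempty (I : GraphInput n) : I.edgeAnswers.Nonempty := by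
  classical
  unfold edgeAnswers
  split_ifs with h
  · exact h.image _
  · exact Finset.singleton_nonempty _

/-- The distribution of the output of a deterministic algorithm on the input `I`. The random edges
returned by the oracle are uniform and independent of each other. -/
noncomputable def outDist (I : GraphInput n) : QueryAlg n → PMF ℝ
  | .output s => PMF.pure s
  | .degree v next => I.outDist (next (I.deg v))
  | .neighbor v i next => I.outDist (next (I.adj v)[i]?)
  | .randomEdge next =>
      (PMF.uniformOfFinset I.edgeAnswers I.edgeAnswers_nonempty).bind fun e => I.outDist (next e)

/-- The largest number of queries, of any type, that a deterministic algorithm makes on the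
input `I`, over all possible answers to its random edge queries. -/
noncomputable def queries (I : GraphInput n) : QueryAlg n → ℕ
  | .output _ => 0
  | .degree v next => I.queries (next (I.deg v)) + 1
  | .neighbor v i next => I.queries (next (I.adj v)[i]?) + 1
  | .randomEdge next => (I.edgeAnswers.sup fun e => I.queries (next e)) + 1

end GraphInput

/-- A randomized algorithm: a deterministic algorithm that depends on a random seed `ω`,
drawn from some probability space independently of the oracle. -/
structure RandomizedAlg (n : ℕ) where
  Ω : Type
  [measurableSpace : MeasurableSpace Ω]
  μ : Measure Ω
  [isProbabilityMeasure : IsProbabilityMeasure μ]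
  alg : Ω → QueryAlg n

attribute [instance] RandomizedAlg.measurableSpace RandomizedAlg.isProbabilityMeasure

namespace RandomizedAlg

variable {n : ℕ}

/-- On the input `I` the algorithm makes at most `T` queries (almost surely in its seed, and for all
possible answers to its random edge queries). -/
def MakesAtMost (R : RandomizedAlg n) (I : GraphInput n) (T : ℕ) : Prop :=
  ∀ᵐ ω ∂(R.μ), I.queries (R.alg ω) ≤ T

/-- The probability, over the seed and the oracle, that on the input `I` the algorithm outputs a
value in the interval `[a * S_p, b * S_p]`. -/
noncomputable def successProb (R : RandomizedAlg n) (I : GraphInput n) (p : ℕ) (a b : ℝ) : ℝ≥0∞ :=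
  ∫⁻ ω, (I.outDist (R.alg ω)).toMeasure
    (Set.Icc (a * (I.starCount p : ℝ)) (b * (I.starCount p : ℝ))) ∂(R.μ)

end RandomizedAlg

/-- Every randomized algorithm that, on all inputs on `n` vertices with `lo ≤ S_p ≤ hi`, outputs
a value in `[a * S_p, b * S_p]` with probability at least `2/3` and makes at most `T` queries, has
`T ≥ L`. (The algorithm may depend on `n` and on all parameters, and is not restricted on other
inputs.) -/
def RequiresQueries (n p : ℕ) (lo hi a b L : ℝ) : Prop :=
  ∀ (R : RandomizedAlg n) (T : ℕ),
    (∀ I : GraphInput n, lo ≤ (I.starCount p : ℝ) → (I.starCount p : ℝ) ≤ hi →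
      2 / 3 ≤ R.successProb I p a b ∧ R.MakesAtMost I T) →
    L ≤ (T : ℝ)

/-- The constraints on the parameters of the hard instances. -/
structure ValidParams (n₁ d₁ n₂ d₂ : ℕ) : Prop where
  n₁_pos : 0 < n₁
  d₁_pos : 0 < d₁
  n₂_pos : 0 < n₂
  d₂_pos : 0 < d₂
  d₁_even : Even d₁
  n₂_even : Even n₂
  n₂_le : n₂ ≤ d₁
  d₁_le : d₁ ≤ 2 * d₂
  lt_n₁ : d₁ + 2 * d₂ < n₁

/-- The number of `p`-stars in a graph with `n₁` vertices of degree `d₁` and all other vertices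
isolated. -/
def s₁ (p n₁ d₁ : ℕ) : ℕ := n₁ * d₁.choose p

/-- The number of `p`-stars in a graph with `n₁` vertices of degree `d₁` and `n₂` vertices of
degree `d₂`. -/
def s₂ (p n₁ d₁ n₂ d₂ : ℕ) : ℕ := n₁ * d₁.choose p + n₂ * d₂.choose p

/-- The ratio `r`. -/
noncomputable def ratio (n₁ d₁ n₂ d₂ : ℕ) : ℝ :=
  (((d₁ : ℝ) + d₂) * n₂) / ((d₁ : ℝ) * n₁)

end StarCounting

/-!
Every input of the hard family is close to one fixed graph `I₀`. Of the `n₁ + n₂` vertices,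
`N = ⌈n₁ / 2⌉` form a circulant graph, in which each vertex `v` of `ZMod N` is joined to
`v ± 1, …, v ± m` with `m = d₁ / 2`; the other `M = n₁ + n₂ - N` vertices are isolated. A random
instance deletes from it the edges `{x, x + t}` where `t` runs through `h = n₂ / 2` cyclically
consecutive lengths and `x` through `e` cyclically consecutive positions. For every such `t` two of
the isolated vertices take over: one is joined to all the points `x`, the other to all the points
`x + t`, and every new edge stands in the adjacency lists in the slot of the deleted one. So all
degrees in the circulant graph stay `d₁`, and `n₂` formerly isolated vertices obtain the degree `e`
(`starCount_instanceOf`). The lengths, the positions and the two-per-length vertices are shifted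
by independent uniform cyclic shifts.

For `e = d₂` the number of `p`-stars grows at least by the factor `c`; since `e.choose p` does not
jump when `e` grows by one, some `e ≤ d₂` gives a growth by at least `c` and at most `(p + 1) c`
(`exists_le_mul_choose`). Thus all instances are admissible, and an output that is correct for `I₀`
is wrong for every random instance.

On the other hand, a random instance answers any given query as `I₀` does, except with probability
at most `4 r`. A vertex outside of the circulant graph is in use with probability `n₂ / M`
(`card_hub_le`). A slot of a vertex of the circulant graph is changed with probability
`(e / N) (h / m)` (`card_cut`). The distributions of a random edge differ by at most the fraction of
the new edges, `n₂ e` among at least `N m` (`card_edgeFinset_sdiff_le`).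

Since `I₀` is fixed, adaptivity is no obstacle: an induction on the decision tree replaces the
answers of the random instance by those of `I₀`, one by one, at the cost `4 r` each
(`GraphInput.sum_outDist_le`). The success events on `I₀` and on the random instance being disjoint,
`4 / 3 ≤ 1 + 4 r T`, that is `T ≥ 1 / (12 r)`.
-/

namespace StarCounting

/-! ### Averaging over a family of inputs -/

namespace GraphInput

variable {n : ℕ}

theorem deg_eq_length_adj (I : GraphInput n) (v : Fin n) : I.deg v = (I.adj v).length := by
  classical
  rw [← List.toFinset_card_of_nodup (I.nodup_adj v), deg,
    ← SimpleGraph.card_neighborFinset_eq_degree]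
  congr 1
  ext w
  simp [I.mem_adj]

open Classical in
theorem two_mul_card_edgeFinset (I : GraphInput n) :
    2 * I.graph.edgeFinset.card = ∑ v, I.deg v := by
  rw [← SimpleGraph.sum_degrees_eq_twice_card_edges]
  exact Finset.sum_congr rfl fun v _ => by unfold deg; congr

theorem outDist_apply_le_one (I : GraphInput n) (A : QueryAlg n) (S : Set ℝ) :
    (I.outDist A).toOuterMeasure S ≤ 1 := by
  rw [PMF.toOuterMeasure_apply, ← (I.outDist A).tsum_coe]
  exact ENNReal.tsum_le_tsum fun x => Set.indicator_le_self S _ x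

/-- Replacing the answers `ans θ` of the oracle by a fixed answer `a₀` changes a sum of
probabilities by at most the number of `θ` for which they differ. -/
theorem sum_le_sum_add_card_ne {Θ β : Type*} [Fintype Θ] [DecidableEq β] (F : Θ → β → ℝ≥0∞)
    (hF : ∀ θ x, F θ x ≤ 1) (ans : Θ → β) (a₀ : β) :
    ∑ θ, F θ (ans θ) ≤ ∑ θ, F θ a₀ + (({θ | ans θ ≠ a₀} : Finset Θ).card : ℝ≥0∞) := by
  rw [Finset.card_filter, Nat.cast_sum, ← Finset.sum_add_distrib]
  refine Finset.sum_le_sum fun θ _ => ?_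
  by_cases h : ans θ = a₀
  · simp [h]
  · simpa [h] using (hF θ (ans θ)).trans le_add_self

/-- If a random input agrees with the fixed input `I₀` on every single query up to probability `δ`,
then any event has at most `T * δ` more probability on the random input than on `I₀`, for a
deterministic algorithm making at most `T` queries on `I₀`. Adaptivity is harmless: the queries
made on `I₀` do not depend on `θ`, so at every node of the decision tree it is enough to replace the
answer of `I θ` by that of `I₀`, at the cost of `δ`. -/
theorem sum_outDist_le {Θ : Type*} [Fintype Θ] (I₀ : GraphInput n) (I : Θ → GraphInput n)
    (δ : ℝ≥0∞) (S : Set ℝ)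
    (hdeg : ∀ v, (({θ | (I θ).deg v ≠ I₀.deg v} : Finset Θ).card : ℝ≥0∞) ≤ Fintype.card Θ * δ)
    (hadj : ∀ v (i : ℕ), (({θ | ((I θ).adj v)[i]? ≠ (I₀.adj v)[i]?} : Finset Θ).card : ℝ≥0∞) ≤
      Fintype.card Θ * δ)
    (hedge : ∀ θ (g : Option (Sym2 (Fin n)) → ℝ≥0∞), (∀ x, g x ≤ 1) →
      ∑' x, PMF.uniformOfFinset (I θ).edgeAnswers (I θ).edgeAnswers_nonempty x * g x ≤
        ∑' x, PMF.uniformOfFinset I₀.edgeAnswers I₀.edgeAnswers_nonempty x * g x + δ)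
    (A : QueryAlg n) (T : ℕ) (hT : I₀.queries A ≤ T) :
    ∑ θ, ((I θ).outDist A).toOuterMeasure S ≤
      Fintype.card Θ * ((I₀.outDist A).toOuterMeasure S + T * δ) := by
  -- One query costs `δ`, and leaves at most `T` queries to be paid for.
  have step : ∀ (x : ℝ≥0∞) (T : ℕ), (Fintype.card Θ : ℝ≥0∞) * (x + T * δ) + Fintype.card Θ * δ =
      Fintype.card Θ * (x + (T + 1 : ℕ) * δ) := fun x T => by push_cast; ring
  induction A generalizing T with
  | output s =>
    simp only [outDist, Finset.sum_const, Finset.card_univ, nsmul_eq_mul]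
    gcongr
    exact le_self_add
  | degree v next ih =>
    obtain ⟨T, rfl⟩ : ∃ T', T = T' + 1 := ⟨T - 1, by simp only [queries] at hT; omega⟩
    simp only [queries, add_le_add_iff_right] at hT
    rw [← step]
    exact (sum_le_sum_add_card_ne (fun θ x => ((I θ).outDist (next x)).toOuterMeasure S)
      (fun θ x => outDist_apply_le_one _ _ _) (fun θ => (I θ).deg v) (I₀.deg v)).trans
        (add_le_add (ih _ T hT) (hdeg v))
  | neighbor v i next ih =>
    obtain ⟨T, rfl⟩ : ∃ T', T = T' + 1 := ⟨T - 1, by simp only [queries] at hT; omega⟩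
    simp only [queries, add_le_add_iff_right] at hT
    rw [← step]
    exact (sum_le_sum_add_card_ne (fun θ x => ((I θ).outDist (next x)).toOuterMeasure S)
      (fun θ x => outDist_apply_le_one _ _ _) (fun θ => ((I θ).adj v)[i]?)
        ((I₀.adj v)[i]?)).trans (add_le_add (ih _ T hT) (hadj v i))
  | randomEdge next ih =>
    obtain ⟨T, rfl⟩ : ∃ T', T = T' + 1 := ⟨T - 1, by simp only [queries] at hT; omega⟩
    simp only [queries, add_le_add_iff_right, Finset.sup_le_iff] at hT
    rw [← step]
    simp only [outDist, PMF.toOuterMeasure_bind_apply]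
    set p₀ := PMF.uniformOfFinset I₀.edgeAnswers I₀.edgeAnswers_nonempty
    have key : ∑' x, p₀ x * ∑ θ, ((I θ).outDist (next x)).toOuterMeasure S ≤
        ∑' x, p₀ x * (Fintype.card Θ * ((I₀.outDist (next x)).toOuterMeasure S + T * δ)) := by
      refine ENNReal.tsum_le_tsum fun x => ?_
      by_cases hx : x ∈ I₀.edgeAnswers
      · exact mul_le_mul_right (ih x T (hT x hx)) _
      · simp [p₀, PMF.uniformOfFinset_apply_of_notMem _ hx]
    calc _ ≤ ∑ θ, (∑' x, p₀ x * ((I θ).outDist (next x)).toOuterMeasure S + δ) :=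
          Finset.sum_le_sum fun θ _ => hedge θ _ fun x => outDist_apply_le_one _ _ _
      _ = ∑' x, p₀ x * ∑ θ, ((I θ).outDist (next x)).toOuterMeasure S + Fintype.card Θ * δ := by
          rw [Finset.sum_add_distrib, ← Summable.tsum_finsetSum fun _ _ => ENNReal.summable]
          simp [Finset.mul_sum]
      _ ≤ ∑' x, p₀ x * (Fintype.card Θ * ((I₀.outDist (next x)).toOuterMeasure S + T * δ)) +
            Fintype.card Θ * δ := by gcongr
      _ = _ := by
          simp_rw [mul_left_comm (p₀ _), ENNReal.tsum_mul_left, mul_add, ENNReal.tsum_add,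
            ENNReal.tsum_mul_right, p₀.tsum_coe, one_mul]
          ring

/-- The distance of two uniform distributions, on one side. -/
theorem tsum_uniformOfFinset_mul_le {α : Type*} [DecidableEq α] {s t : Finset α}
    (hs : s.Nonempty) (ht : t.Nonempty) (hst : s.card ≤ t.card) (g : α → ℝ≥0∞)
    (hg : ∀ x, g x ≤ 1) :
    ∑' x, PMF.uniformOfFinset t ht x * g x ≤
      ∑' x, PMF.uniformOfFinset s hs x * g x + ((t \ s).card : ℝ≥0∞) / t.card := by
  have hd : ((t \ s).card : ℝ≥0∞) / t.card =
      ∑' x, if x ∈ t \ s then (t.card : ℝ≥0∞)⁻¹ else 0 := by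
    rw [tsum_eq_sum (s := t \ s) (fun x hx => by simp only [hx, if_false]),
      Finset.sum_congr rfl fun x hx => if_pos hx]
    simp [div_eq_mul_inv]
  rw [hd, ← ENNReal.tsum_add]
  refine ENNReal.tsum_le_tsum fun x => ?_
  by_cases hx : x ∈ t
  · rw [PMF.uniformOfFinset_apply_of_mem _ hx]
    by_cases hx' : x ∈ s
    · rw [PMF.uniformOfFinset_apply_of_mem _ hx']
      refine le_add_right ?_
      gcongr
    · rw [if_pos (Finset.mem_sdiff.2 ⟨hx, hx'⟩)]
      exact le_add_left (mul_le_of_le_one_right' (hg x))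
  · simp [PMF.uniformOfFinset_apply_of_notMem _ hx]

open Classical in
/-- A random edge query answers almost alike on two graphs, if few edges of the second are new and
the second has no fewer edges than the first. -/
theorem tsum_edgeAnswers_mul_le (I₀ I : GraphInput n) (h₀ : I₀.graph.edgeFinset.Nonempty)
    (hcard : I₀.graph.edgeFinset.card ≤ I.graph.edgeFinset.card)
    (g : Option (Sym2 (Fin n)) → ℝ≥0∞) (hg : ∀ x, g x ≤ 1) :
    ∑' x, PMF.uniformOfFinset I.edgeAnswers I.edgeAnswers_nonempty x * g x ≤
      ∑' x, PMF.uniformOfFinset I₀.edgeAnswers I₀.edgeAnswers_nonempty x * g x +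
        ((I.graph.edgeFinset \ I₀.graph.edgeFinset).card : ℝ≥0∞) / I.graph.edgeFinset.card := by
  have h : I.graph.edgeFinset.Nonempty := Finset.card_pos.1 (h₀.card_pos.trans_le hcard)
  have e₀ : I₀.edgeAnswers = I₀.graph.edgeFinset.image some := if_pos h₀
  have e : I.edgeAnswers = I.graph.edgeFinset.image some := if_pos h
  have inj := Option.some_injective (Sym2 (Fin n))
  have := tsum_uniformOfFinset_mul_le I₀.edgeAnswers_nonempty I.edgeAnswers_nonempty
    (by rwa [e₀, e, Finset.card_image_of_injective _ inj, Finset.card_image_of_injective _ inj])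
    g hg
  rwa [show (I.edgeAnswers \ I₀.edgeAnswers).card =
      (I.graph.edgeFinset \ I₀.graph.edgeFinset).card by
        rw [e₀, e, ← Finset.image_sdiff _ _ inj, Finset.card_image_of_injective _ inj],
    show I.edgeAnswers.card = I.graph.edgeFinset.card by
        rw [e, Finset.card_image_of_injective _ inj]] at this

end GraphInput

/-- The lower bound that an indistinguishable family gives. The two events `[a S_p, b S_p]`
for `I₀` and for `I θ` are disjoint, and each has probability at least `2 / 3`, whence
`4 / 3 ≤ 1 + T * δ`. -/
theorem RandomizedAlg.one_le_three_mul {n p : ℕ} {Θ : Type*} [Fintype Θ] [Nonempty Θ]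
    (I₀ : GraphInput n) (I : Θ → GraphInput n) (δ : ℝ≥0∞)
    (hdeg : ∀ v, (({θ | (I θ).deg v ≠ I₀.deg v} : Finset Θ).card : ℝ≥0∞) ≤ Fintype.card Θ * δ)
    (hadj : ∀ v (i : ℕ), (({θ | ((I θ).adj v)[i]? ≠ (I₀.adj v)[i]?} : Finset Θ).card : ℝ≥0∞) ≤
      Fintype.card Θ * δ)
    (hedge : ∀ θ (g : Option (Sym2 (Fin n)) → ℝ≥0∞), (∀ x, g x ≤ 1) →
      ∑' x, PMF.uniformOfFinset (I θ).edgeAnswers (I θ).edgeAnswers_nonempty x * g x ≤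
        ∑' x, PMF.uniformOfFinset I₀.edgeAnswers I₀.edgeAnswers_nonempty x * g x + δ)
    {a b : ℝ} {s : ℕ} (hs : ∀ θ, (I θ).starCount p = s)
    (hsep : b * (I₀.starCount p : ℝ) < a * (s : ℝ))
    (R : RandomizedAlg n) (T : ℕ) (hT : R.MakesAtMost I₀ T)
    (h₀ : 2 / 3 ≤ R.successProb I₀ p a b) (h : ∀ θ, 2 / 3 ≤ R.successProb (I θ) p a b) :
    1 ≤ 3 * (T * δ) := by
  set J₀ := Set.Icc (a * (I₀.starCount p : ℝ)) (b * (I₀.starCount p : ℝ))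
  set J := Set.Icc (a * (s : ℝ)) (b * (s : ℝ))
  have hdisj : Disjoint J₀ J :=
    Set.disjoint_left.2 fun x hx hx' => (hx.2.trans_lt hsep).not_ge hx'.1
  set P₀ : R.Ω → ℝ≥0∞ := fun ω => (I₀.outDist (R.alg ω)).toMeasure J₀
  set P : Θ → R.Ω → ℝ≥0∞ := fun θ ω => ((I θ).outDist (R.alg ω)).toMeasure J
  have hP : ∀ θ, 2 / 3 ≤ ∫⁻ ω, P θ ω ∂(R.μ) := fun θ => by
    have := h θ
    rwa [RandomizedAlg.successProb, hs] at this
  -- The integrands need not be measurable; the lower integral is superadditive all the same.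
  have hsuper : ∀ t : Finset Θ, ∑ θ ∈ t, (∫⁻ ω, P₀ ω ∂(R.μ) + ∫⁻ ω, P θ ω ∂(R.μ)) ≤
      ∫⁻ ω, ∑ θ ∈ t, (P₀ ω + P θ ω) ∂(R.μ) := by
    classical
    intro t
    induction t using Finset.induction_on with
    | empty => simp
    | insert θ t hθ ih =>
      simp_rw [Finset.sum_insert hθ]
      exact (add_le_add (le_lintegral_add _ _) ih).trans (le_lintegral_add _ _)
  have hpt : ∀ᵐ ω ∂(R.μ), ∑ θ, (P₀ ω + P θ ω) ≤ Fintype.card Θ * (1 + T * δ) := by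
    filter_upwards [hT] with ω hω
    have hsum := GraphInput.sum_outDist_le I₀ I δ J hdeg hadj hedge (R.alg ω) T hω
    have hle : P₀ ω + (I₀.outDist (R.alg ω)).toOuterMeasure J ≤ 1 := by
      rw [← PMF.toMeasure_apply_eq_toOuterMeasure_apply _ measurableSet_Icc,
        ← measure_union hdisj measurableSet_Icc]
      exact prob_le_one
    rw [Finset.sum_add_distrib]
    calc _ ≤ (Fintype.card Θ : ℝ≥0∞) * P₀ ω +
          Fintype.card Θ * ((I₀.outDist (R.alg ω)).toOuterMeasure J + T * δ) := by
          refine add_le_add (by simp) (le_of_eq_of_le ?_ hsum)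
          exact Finset.sum_congr rfl fun θ _ =>
            PMF.toMeasure_apply_eq_toOuterMeasure_apply _ measurableSet_Icc
      _ = Fintype.card Θ * (P₀ ω + (I₀.outDist (R.alg ω)).toOuterMeasure J + T * δ) := by ring
      _ ≤ _ := by gcongr
  have htot : (Fintype.card Θ : ℝ≥0∞) * (2 / 3 + 2 / 3) ≤ Fintype.card Θ * (1 + T * δ) := by
    calc (Fintype.card Θ : ℝ≥0∞) * (2 / 3 + 2 / 3) = ∑ _θ : Θ, (2 / 3 + 2 / 3) := by simp [mul_add]
      _ ≤ ∑ θ, (∫⁻ ω, P₀ ω ∂(R.μ) + ∫⁻ ω, P θ ω ∂(R.μ)) :=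
          Finset.sum_le_sum fun θ _ => add_le_add h₀ (hP θ)
      _ ≤ ∫⁻ ω, ∑ θ, (P₀ ω + P θ ω) ∂(R.μ) := hsuper _
      _ ≤ ∫⁻ _, (Fintype.card Θ * (1 + T * δ) : ℝ≥0∞) ∂(R.μ) := lintegral_mono_ae hpt
      _ = _ := by simp
  rw [ENNReal.mul_le_mul_iff_right (by simp) (by simp)] at htot
  by_contra! hlt
  rcases eq_or_ne (T * δ) ⊤ with htop | htop
  · simp [htop] at hlt
  lift (T * δ : ℝ≥0∞) to NNReal using htop with x
  have h1 : (2 / 3 + 2 / 3 : NNReal) ≤ 1 + x := by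
    have e : ((2 / 3 : NNReal) : ℝ≥0∞) = 2 / 3 := by
      rw [ENNReal.coe_div (by norm_num)]; norm_num
    exact_mod_cast (by rw [ENNReal.coe_add, e]; exact_mod_cast htot :
      ((2 / 3 + 2 / 3 : NNReal) : ℝ≥0∞) ≤ 1 + x)
  have h2 : 3 * x < 1 := by exact_mod_cast hlt
  rw [← NNReal.coe_le_coe] at h1
  rw [← NNReal.coe_lt_coe] at h2
  push_cast at h1 h2
  linarith

/-! ### The hard instances -/

theorem card_val_lt {N : ℕ} [NeZero N] {e : ℕ} (he : e ≤ N) :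
    ({x | x.val < e} : Finset (ZMod N)).card = e := by
  rw [← Finset.card_image_of_injective _ (ZMod.val_injective N)]
  conv_rhs => rw [← Finset.card_range e]
  congr 1
  ext k
  simp only [Finset.mem_image, Finset.mem_filter, Finset.mem_univ, true_and, Finset.mem_range]
  constructor
  · rintro ⟨x, hx, rfl⟩
    exact hx
  · intro hk
    exact ⟨k, by rwa [ZMod.val_natCast_of_lt (hk.trans_le he)],
      ZMod.val_natCast_of_lt (hk.trans_le he)⟩

/-- The slots of the adjacency list of a vertex of the circulant graph: `(t, true)` stands for the
neighbour at distance `t + 1` forward, `(t, false)` for the one at distance `t + 1` backward. -/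
abbrev Slot (m : ℕ) := ZMod m × Bool

/-- The parameters `(ρ, τ, σ)` of a random instance: `ρ` shifts the positions of the deleted
edges, `τ` their lengths, and `σ` the vertices outside of the circulant graph to which the ends of
the deleted edges are joined. -/
abbrev Shift (N m M : ℕ) := ZMod N × ZMod m × ZMod M

section Construction

set_option linter.unusedSectionVars false

variable {N m M : ℕ} [NeZero N] [NeZero m] [NeZero M]

/-- The displacement from a vertex of the circulant graph to its neighbour in a given slot. -/
def disp (N : ℕ) {m : ℕ} : Slot m → ZMod N
  | (t, true) => (t.val + 1 : ℕ)
  | (t, false) => -(t.val + 1 : ℕ)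

/-- The starting point of the edge in slot `s` of the vertex `v`: the end from which the edge goes
forward. -/
def base (v : ZMod N) : Slot m → ZMod N
  | (_, true) => v
  | (t, false) => v - (t.val + 1 : ℕ)

/-- The slot in which an edge appears at its other end. -/
def Slot.rev (s : Slot m) : Slot m := (s.1, !s.2)

/-- A fixed numbering of the slots. -/
def slotIndex (M : ℕ) {m : ℕ} (s : Slot m) : ZMod M :=
  (s.1.val + if s.2 then m else 0 : ℕ)

/-- Edges whose length is `t + 1` are deleted (at some positions) for `h` values of `t`. -/
def Hot (h : ℕ) (θ : Shift N m M) (s : Slot m) : Prop := (s.1 - θ.2.1).val < h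

/-- The edge in slot `s` at `v` is deleted: its length is among the `h` chosen ones and its starting
point among the `e` chosen ones. -/
def Cut (h e : ℕ) (θ : Shift N m M) (v : ZMod N) (s : Slot m) : Prop :=
  (base v s - θ.1).val < e ∧ Hot h θ s

/-- The outside vertex that takes over the deleted edges from their ends with slot `s`. -/
def hub (θ : Shift N m M) (s : Slot m) : ZMod M := θ.2.2 + slotIndex M s

open Classical in
/-- The neighbour of `v` in slot `s`. -/
noncomputable def slotNeighbor (h e : ℕ) (θ : Shift N m M) (v : ZMod N) (s : Slot m) :
    ZMod N ⊕ ZMod M :=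
  if Cut h e θ v s then .inr (hub θ s) else .inl (v + disp N s)

/-- The outside vertex `u` is joined to the vertex `v` of the circulant graph. -/
def Joined (h e : ℕ) (θ : Shift N m M) (v : ZMod N) (u : ZMod M) : Prop :=
  ∃ s : Slot m, Cut h e θ v s ∧ hub θ s = u

open Classical in
/-- The adjacency lists of an instance on the vertex set `ZMod N ⊕ ZMod M`. For `e = 0` this is the
circulant graph on `ZMod N`, all other vertices being isolated. In general the deleted edges are
replaced, in their own slots, by edges to the outside vertices. -/
noncomputable def adjList (h e : ℕ) (θ : Shift N m M) : ZMod N ⊕ ZMod M → List (ZMod N ⊕ ZMod M)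
  | .inl v => (Finset.univ : Finset (Slot m)).toList.map (slotNeighbor h e θ v)
  | .inr u => (Finset.univ.filter fun v => Joined h e θ v u).toList.map .inl

variable {h e : ℕ} {θ : Shift N m M}

theorem natCast_val_add_one_ne {m N : ℕ} [NeZero m] (hN : 2 * m < N) (t t' : ZMod m) :
    ((t.val + 1 : ℕ) : ZMod N) ≠ -((t'.val + 1 : ℕ) : ZMod N) := by
  intro hh
  have := t.val_lt
  have := t'.val_lt
  rw [← add_eq_zero_iff_eq_neg, ← Nat.cast_add, ZMod.natCast_eq_zero_iff] at hh
  have := Nat.le_of_dvd (by omega) hh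
  omega

theorem disp_injective (hN : 2 * m < N) : Function.Injective (disp N : Slot m → ZMod N) := by
  have inj : ∀ t t' : ZMod m, ((t.val + 1 : ℕ) : ZMod N) = (t'.val + 1 : ℕ) → t = t' := by
    intro t t' hh
    have := t.val_lt
    have := t'.val_lt
    have := congrArg ZMod.val hh
    rw [ZMod.val_natCast_of_lt (by omega), ZMod.val_natCast_of_lt (by omega)] at this
    exact ZMod.val_injective m (by omega)
  rintro ⟨t, _ | _⟩ ⟨t', _ | _⟩ hh <;> simp only [disp] at hh
  · rw [inj t t' (neg_injective hh)]
  · exact (natCast_val_add_one_ne hN t' t hh.symm).elim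
  · exact (natCast_val_add_one_ne hN t t' hh).elim
  · rw [inj t t' hh]

theorem disp_ne_zero (hN : 2 * m < N) (s : Slot m) : disp N s ≠ 0 := by
  intro h0
  have hr : disp N s.rev = - disp N s := by
    rcases s with ⟨t, _ | _⟩ <;> simp [disp, Slot.rev]
  have := disp_injective hN ((hr.trans (by rw [h0, neg_zero])).trans h0.symm)
  simpa [Slot.rev] using congrArg Prod.snd this

theorem slotIndex_injective (hM : 2 * m ≤ M) :
    Function.Injective (slotIndex M : Slot m → ZMod M) := by
  rintro ⟨t, b⟩ ⟨t', b'⟩ hh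
  have := t.val_lt
  have := t'.val_lt
  have hv := congrArg ZMod.val hh
  simp only [slotIndex] at hv
  rw [ZMod.val_natCast_of_lt (by split_ifs <;> omega),
    ZMod.val_natCast_of_lt (by split_ifs <;> omega)] at hv
  have htt : t = t' := ZMod.val_injective m (by split_ifs at hv <;> omega)
  subst htt
  congr 1
  cases b <;> cases b' <;> simp at hv ⊢ <;> omega

theorem hub_injective (hM : 2 * m ≤ M) : Function.Injective (hub θ) :=
  (add_right_injective θ.2.2).comp (slotIndex_injective hM)

theorem slotNeighbor_injective (hN : 2 * m < N) (hM : 2 * m ≤ M) (v : ZMod N) :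
    Function.Injective (slotNeighbor h e θ v) := by
  intro s s' hs
  unfold slotNeighbor at hs
  split_ifs at hs
  · exact hub_injective hM (Sum.inr_injective hs)
  · exact disp_injective hN (add_right_injective v (Sum.inl_injective hs))

theorem nodup_adjList (hN : 2 * m < N) (hM : 2 * m ≤ M) (x : ZMod N ⊕ ZMod M) :
    (adjList h e θ x).Nodup := by
  rcases x with v | u
  · exact (Finset.nodup_toList _).map (slotNeighbor_injective hN hM v)
  · exact (Finset.nodup_toList _).map Sum.inl_injective

theorem inl_mem_adjList_inl {v w : ZMod N} :
    .inl w ∈ adjList h e θ (.inl v) ↔ ∃ s : Slot m, ¬ Cut h e θ v s ∧ v + disp N s = w := by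
  simp only [adjList, List.mem_map, Finset.mem_toList, Finset.mem_univ, true_and, slotNeighbor]
  refine exists_congr fun s => ?_
  split_ifs with hc <;> simp [hc]

theorem inr_mem_adjList_inl {v : ZMod N} {u : ZMod M} :
    .inr u ∈ adjList h e θ (.inl v) ↔ Joined h e θ v u := by
  simp only [adjList, List.mem_map, Finset.mem_toList, Finset.mem_univ, true_and, slotNeighbor,
    Joined]
  refine exists_congr fun s => ?_
  split_ifs with hc <;> simp [hc]

theorem inl_mem_adjList_inr {v : ZMod N} {u : ZMod M} :
    .inl v ∈ adjList h e θ (.inr u) ↔ Joined h e θ v u := by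
  simp [adjList]

theorem inr_notMem_adjList_inr {u u' : ZMod M} : .inr u' ∉ adjList h e θ (.inr u) := by
  simp [adjList]

theorem base_add_disp_rev (v : ZMod N) (s : Slot m) : base (v + disp N s) s.rev = base v s := by
  rcases s with ⟨t, _ | _⟩ <;> simp only [base, disp, Slot.rev, Bool.not_true, Bool.not_false] <;> ring

theorem add_disp_add_disp_rev (v : ZMod N) (s : Slot m) : v + disp N s + disp N s.rev = v := by
  rcases s with ⟨t, _ | _⟩ <;> simp only [disp, Slot.rev, Bool.not_true, Bool.not_false] <;> ring

theorem mem_adjList_symm {x y : ZMod N ⊕ ZMod M} (hxy : y ∈ adjList h e θ x) :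
    x ∈ adjList h e θ y := by
  rcases x with v | u <;> rcases y with w | u'
  · rw [inl_mem_adjList_inl] at hxy ⊢
    obtain ⟨s, hs, rfl⟩ := hxy
    refine ⟨s.rev, ?_, add_disp_add_disp_rev v s⟩
    rwa [Cut, base_add_disp_rev]
  · rwa [inl_mem_adjList_inr, ← inr_mem_adjList_inl]
  · rwa [inr_mem_adjList_inl, ← inl_mem_adjList_inr]
  · exact (inr_notMem_adjList_inr hxy).elim

theorem notMem_adjList_self (hN : 2 * m < N) (x : ZMod N ⊕ ZMod M) : x ∉ adjList h e θ x := by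
  rcases x with v | u
  · rw [inl_mem_adjList_inl]
    rintro ⟨s, -, hs⟩
    exact disp_ne_zero hN s (by simpa using hs)
  · exact inr_notMem_adjList_inr

/-- The instance with the adjacency lists `adjList h e θ`, its vertices being numbered by `φ`. -/
noncomputable def instanceOf {n : ℕ} (φ : ZMod N ⊕ ZMod M ≃ Fin n) (hN : 2 * m < N)
    (hM : 2 * m ≤ M) (h e : ℕ) (θ : Shift N m M) : GraphInput n where
  graph :=
    { Adj := fun x y => φ.symm y ∈ adjList h e θ (φ.symm x)
      symm := ⟨fun _ _ hxy => mem_adjList_symm hxy⟩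
      loopless := ⟨fun _ hx => notMem_adjList_self hN _ hx⟩ }
  adj := fun x => (adjList h e θ (φ.symm x)).map φ
  nodup_adj := fun x => (nodup_adjList hN hM _).map φ.injective
  mem_adj := fun x y => by
    simp only [List.mem_map]
    exact ⟨by rintro ⟨a, ha, rfl⟩; simpa using ha, fun hy => ⟨_, hy, by simp⟩⟩

/-! ### Degrees, stars and edges of the instances -/

theorem length_adjList_inl (v : ZMod N) : (adjList h e θ (.inl v)).length = 2 * m := by
  simp [adjList, ZMod.card, mul_comm]

theorem base_bijective (s : Slot m) : Function.Bijective fun v : ZMod N => base v s := by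
  rcases s with ⟨t, _ | _⟩
  · exact (Equiv.subRight _).bijective
  · exact Function.bijective_id

open Classical in
theorem length_adjList_inr_hub (hM : 2 * m ≤ M) (he : e ≤ N) {s : Slot m} (hs : Hot h θ s) :
    (adjList h e θ (.inr (hub θ s))).length = e := by
  simp only [adjList, List.length_map, Finset.length_toList]
  conv_rhs => rw [← card_val_lt he]
  refine Finset.card_bijective (fun v => base v s - θ.1)
    ((Equiv.subRight θ.1).bijective.comp (base_bijective s)) fun v => ?_
  simp only [Finset.mem_filter, Finset.mem_univ, true_and]
  constructor
  · rintro ⟨s', hs', hh⟩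
    rw [hub_injective hM hh] at hs'
    exact hs'.1
  · exact fun hv => ⟨s, ⟨hv, hs⟩, rfl⟩

theorem adjList_inr_eq_nil {u : ZMod M} (hu : ¬ ∃ s, Hot h θ s ∧ hub θ s = u) :
    adjList h e θ (.inr u) = [] := by
  refine List.eq_nil_iff_forall_not_mem.2 fun x hx => ?_
  rcases x with v | u'
  · obtain ⟨s, hs, rfl⟩ := inl_mem_adjList_inr.1 hx
    exact hu ⟨s, hs.2, rfl⟩
  · exact inr_notMem_adjList_inr hx

open Classical in
theorem card_hot (hh : h ≤ m) (θ : Shift N m M) :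
    ({s | Hot h θ s} : Finset (Slot m)).card = 2 * h := by
  have : ({s | Hot h θ s} : Finset (Slot m)) =
      (({t | (t - θ.2.1).val < h} : Finset (ZMod m)) ×ˢ Finset.univ) := by
    ext ⟨t, b⟩
    simp only [Finset.mem_filter, Finset.mem_product, Finset.mem_univ, true_and, and_true]
    rfl
  rw [this, Finset.card_product, Finset.card_univ, Fintype.card_bool, mul_comm]
  congr 1
  conv_rhs => rw [← card_val_lt hh]
  exact Finset.card_bijective _ (Equiv.subRight θ.2.1).bijective fun t => by simp

open Classical in
/-- A sum over the outside vertices of a function of the degree. -/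
theorem sum_length_adjList_inr (hM : 2 * m ≤ M) (he : e ≤ N) (hh : h ≤ m) {g : ℕ → ℕ}
    (hg : g 0 = 0) : ∑ u, g (adjList h e θ (.inr u)).length = 2 * h * g e := by
  rw [← card_hot hh θ, ← smul_eq_mul, ← Finset.sum_const]
  rw [← Finset.sum_subset (Finset.subset_univ
    (({s | Hot h θ s} : Finset (Slot m)).image (hub θ))), Finset.sum_image]
  · exact Finset.sum_congr rfl fun s hs => by
      rw [length_adjList_inr_hub hM he (Finset.mem_filter.1 hs).2]
  · exact fun s _ s' _ hss => hub_injective hM hss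
  · intro u _ hu
    rw [adjList_inr_eq_nil (by simpa using hu), List.length_nil, hg]

variable {n : ℕ} {φ : ZMod N ⊕ ZMod M ≃ Fin n} {hN : 2 * m < N} {hM : 2 * m ≤ M}

theorem deg_instanceOf (x : Fin n) :
    (instanceOf φ hN hM h e θ).deg x = (adjList h e θ (φ.symm x)).length := by
  rw [GraphInput.deg_eq_length_adj]
  exact List.length_map ..

theorem sum_deg_instanceOf (he : e ≤ N) (hh : h ≤ m) {g : ℕ → ℕ} (hg : g 0 = 0) :
    ∑ x, g ((instanceOf φ hN hM h e θ).deg x) = N * g (2 * m) + 2 * h * g e := by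
  simp_rw [deg_instanceOf]
  rw [Equiv.sum_comp φ.symm fun y => g (adjList h e θ y).length, Fintype.sum_sum_type,
    sum_length_adjList_inr hM he hh hg]
  simp [length_adjList_inl, ZMod.card]

theorem starCount_instanceOf {p : ℕ} (hp : p ≠ 0) (he : e ≤ N) (hh : h ≤ m) :
    (instanceOf φ hN hM h e θ).starCount p = N * (2 * m).choose p + 2 * h * e.choose p := by
  unfold GraphInput.starCount
  exact sum_deg_instanceOf he hh (g := fun k => k.choose p)
    (Nat.choose_eq_zero_of_lt (Nat.pos_of_ne_zero hp))

open Classical in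
theorem card_edgeFinset_instanceOf (he : e ≤ N) (hh : h ≤ m) :
    (instanceOf φ hN hM h e θ).graph.edgeFinset.card = N * m + h * e := by
  have := (instanceOf φ hN hM h e θ).two_mul_card_edgeFinset
  have hsum := sum_deg_instanceOf (φ := φ) (hN := hN) (hM := hM) (θ := θ) he hh (g := id) rfl
  simp only [id] at hsum
  rw [hsum] at this
  linarith

open Classical in
/-- Every new edge has an end outside of the circulant graph. -/
theorem card_edgeFinset_sdiff_le (he : e ≤ N) (hh : h ≤ m) (θ₀ : Shift N m M) :
    ((instanceOf φ hN hM h e θ).graph.edgeFinset \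
      (instanceOf φ hN hM h 0 θ₀).graph.edgeFinset).card ≤ 2 * h * e := by
  set I := instanceOf φ hN hM h e θ
  have hsub : I.graph.edgeFinset \ (instanceOf φ hN hM h 0 θ₀).graph.edgeFinset ⊆
      Finset.univ.biUnion fun u : ZMod M => I.graph.incidenceFinset (φ (.inr u)) := by
    intro z
    induction z using Sym2.ind with
    | _ x y =>
      simp only [Finset.mem_sdiff, SimpleGraph.mem_edgeFinset, SimpleGraph.mem_edgeSet,
        Finset.mem_biUnion, Finset.mem_univ, true_and, SimpleGraph.mem_incidenceFinset,
        SimpleGraph.mk'_mem_incidenceSet_iff]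
      rintro ⟨hI, h₀⟩
      rcases hx : φ.symm x with v | u
      · rcases hy : φ.symm y with w | u
        · refine (h₀ ?_).elim
          change φ.symm y ∈ adjList h e θ (φ.symm x) at hI
          change φ.symm y ∈ adjList h 0 θ₀ (φ.symm x)
          rw [hx, hy, inl_mem_adjList_inl] at hI ⊢
          obtain ⟨s, -, hs⟩ := hI
          exact ⟨s, by simp [Cut], hs⟩
        · exact ⟨u, hI, Or.inr (by rw [← hy, φ.apply_symm_apply])⟩
      · exact ⟨u, hI, Or.inl (by rw [← hx, φ.apply_symm_apply])⟩
  calc _ ≤ ∑ u : ZMod M, (I.graph.incidenceFinset (φ (.inr u))).card :=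
        (Finset.card_le_card hsub).trans Finset.card_biUnion_le
    _ = ∑ u : ZMod M, id (adjList h e θ (.inr u)).length := by
        refine Finset.sum_congr rfl fun u _ => ?_
        rw [SimpleGraph.card_incidenceFinset_eq_degree]
        have := deg_instanceOf (φ := φ) (hN := hN) (hM := hM) (h := h) (e := e) (θ := θ)
          (φ (.inr u))
        rw [φ.symm_apply_apply] at this
        rw [id, ← this]
        unfold GraphInput.deg
        congr
    _ = 2 * h * e := sum_length_adjList_inr hM he hh rfl

/-! ### A single query rarely sees the difference -/

open Classical in
/-- The number of shifts that put the given outside vertex to use. -/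
theorem card_hub_le (hh : h ≤ m) (u : ZMod M) :
    ({θ | ∃ s, Hot h θ s ∧ hub θ s = u} : Finset (Shift N m M)).card ≤ N * m * (2 * h) := by
  have : ({θ | ∃ s, Hot h θ s ∧ hub θ s = u} : Finset (Shift N m M)) ⊆
      (Finset.univ : Finset (ZMod N × ZMod m)).biUnion fun q =>
        ({s | Hot h (q.1, q.2, (0 : ZMod M)) s} : Finset (Slot m)).image
          fun s => (q.1, q.2, u - slotIndex M s) := by
    rintro ⟨ρ, τ, σ⟩ hθ
    obtain ⟨s, hs, rfl⟩ := (Finset.mem_filter.1 hθ).2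
    simp only [Finset.mem_biUnion, Finset.mem_image, Finset.mem_univ, true_and,
      Finset.mem_filter]
    exact ⟨(ρ, τ), s, hs, by simp [hub]⟩
  refine (Finset.card_le_card this).trans (Finset.card_biUnion_le.trans ?_)
  calc _ ≤ ∑ _q : ZMod N × ZMod m, 2 * h :=
        Finset.sum_le_sum fun q _ => Finset.card_image_le.trans (card_hot hh _).le
    _ = _ := by simp [ZMod.card]

open Classical in
/-- The number of shifts that delete the edge in a given slot. -/
theorem card_cut (he : e ≤ N) (hh : h ≤ m) (v : ZMod N) (s : Slot m) :
    ({θ | Cut h e θ v s} : Finset (Shift N m M)).card = e * (h * M) := by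
  have : ({θ | Cut h e θ v s} : Finset (Shift N m M)) =
      ({ρ | (base v s - ρ).val < e} : Finset (ZMod N)) ×ˢ
        (({τ | (s.1 - τ).val < h} : Finset (ZMod m)) ×ˢ (Finset.univ : Finset (ZMod M))) := by
    ext ⟨ρ, τ, σ⟩
    simp only [Finset.mem_filter, Finset.mem_product, Finset.mem_univ, true_and, and_true]
    rfl
  rw [this, Finset.card_product, Finset.card_product, Finset.card_univ, ZMod.card]
  congr 1
  · conv_rhs => rw [← card_val_lt he]
    exact Finset.card_bijective _ (Equiv.subLeft (base v s)).bijective fun t => by simp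
  · congr 1
    conv_rhs => rw [← card_val_lt hh]
    exact Finset.card_bijective _ (Equiv.subLeft s.1).bijective fun t => by simp

open Classical in
theorem card_adj_ne_le (he : e ≤ N) (hh : h ≤ m) (θ₀ : Shift N m M) (x : Fin n) (i : ℕ) :
    ({θ | ((instanceOf φ hN hM h e θ).adj x)[i]? ≠
      ((instanceOf φ hN hM h 0 θ₀).adj x)[i]?} : Finset (Shift N m M)).card ≤
        max (N * m * (2 * h)) (e * (h * M)) := by
  simp only [instanceOf, List.getElem?_map]
  rcases φ.symm x with v | u
  · refine le_max_of_le_right ?_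
    simp only [adjList, List.getElem?_map]
    rcases (Finset.univ : Finset (Slot m)).toList[i]? with _ | s
    · simp
    · rw [← card_cut he hh v s]
      refine Finset.card_le_card fun θ => ?_
      simp only [Finset.mem_filter, Finset.mem_univ, true_and]
      contrapose!
      intro hc
      simp [slotNeighbor, hc, show ¬ Cut h 0 θ₀ v s by simp [Cut]]
  · refine le_max_of_le_left ((Finset.card_le_card fun θ => ?_).trans (card_hub_le hh u))
    simp only [Finset.mem_filter, Finset.mem_univ, true_and]
    contrapose
    intro hu
    rw [adjList_inr_eq_nil hu]
    simp [adjList, Joined, Cut]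

open Classical in
theorem card_deg_ne_le (hh : h ≤ m) (θ₀ : Shift N m M) (x : Fin n) :
    ({θ | (instanceOf φ hN hM h e θ).deg x ≠
      (instanceOf φ hN hM h 0 θ₀).deg x} : Finset (Shift N m M)).card ≤ N * m * (2 * h) := by
  simp only [deg_instanceOf]
  rcases φ.symm x with v | u
  · simp [length_adjList_inl]
  · refine (Finset.card_le_card fun θ => ?_).trans (card_hub_le hh u)
    simp only [Finset.mem_filter, Finset.mem_univ, true_and]
    contrapose
    intro hu
    rw [adjList_inr_eq_nil hu]
    simp [adjList, Joined, Cut]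

end Construction

/-! ### The lower bound for given parameters -/

theorem natCast_le_mul_ofReal {k K : ℕ} {x : ℝ} (hx : (k : ℝ) ≤ K * x) :
    (k : ℝ≥0∞) ≤ K * ENNReal.ofReal x := by
  rw [← ENNReal.ofReal_natCast k, ← ENNReal.ofReal_natCast K, ← ENNReal.ofReal_mul (by positivity)]
  exact ENNReal.ofReal_le_ofReal hx

/-- The lower bound `T ≥ 1 / (3 x)`, where `x` bounds the probability that a query tells a random
instance from the circulant graph. -/
theorem RandomizedAlg.one_le_three_mul_of_instanceOf {n p N m M h e : ℕ} [NeZero N] [NeZero m]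
    [NeZero M] (hp : p ≠ 0) (φ : ZMod N ⊕ ZMod M ≃ Fin n) (hN : 2 * m < N) (hM : 2 * m ≤ M)
    (he : e ≤ N) (hh : h ≤ m) {x : ℝ} (hx : 0 ≤ x) (hx₁ : 2 * (h : ℝ) ≤ M * x)
    (hx₂ : 2 * ((h : ℝ) * e) ≤ N * m * x) {a b : ℝ}
    (hsep : b * (N * (2 * m).choose p : ℕ) <
      a * (N * (2 * m).choose p + 2 * h * e.choose p : ℕ))
    (R : RandomizedAlg n) (T : ℕ) (θ₀ : Shift N m M)
    (hT : R.MakesAtMost (instanceOf φ hN hM h 0 θ₀) T)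
    (h₀ : 2 / 3 ≤ R.successProb (instanceOf φ hN hM h 0 θ₀) p a b)
    (hR : ∀ θ, 2 / 3 ≤ R.successProb (instanceOf φ hN hM h e θ) p a b) :
    1 ≤ 3 * (T * x) := by
  classical
  have hcard : Fintype.card (Shift N m M) = N * m * M := by
    simp [ZMod.card, mul_assoc]
  have hub_le : ((N * m * (2 * h) : ℕ) : ℝ) ≤ (N * m * M : ℕ) * x := by
    push_cast
    rw [mul_assoc ((N : ℝ) * m)]
    gcongr
  have cut_le : ((e * (h * M) : ℕ) : ℝ) ≤ (N * m * M : ℕ) * x := by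
    push_cast
    have : (h : ℝ) * e ≤ N * m * x := by
      have : (0 : ℝ) ≤ (h : ℝ) * e := by positivity
      linarith
    calc (e : ℝ) * (h * M) = h * e * M := by ring
      _ ≤ N * m * x * M := by gcongr
      _ = _ := by ring
  have key := RandomizedAlg.one_le_three_mul (p := p) (instanceOf φ hN hM h 0 θ₀)
    (instanceOf φ hN hM h e) (ENNReal.ofReal x) (a := a) (b := b) ?_ ?_ ?_
    (fun θ => starCount_instanceOf hp he hh)
    (by
      rw [starCount_instanceOf hp (Nat.zero_le N) hh]
      simpa [Nat.choose_eq_zero_of_lt (Nat.pos_of_ne_zero hp)] using hsep) R T hT h₀ hR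
  · rw [← ENNReal.ofReal_natCast T, ← ENNReal.ofReal_mul (by positivity),
      show (3 : ℝ≥0∞) = ENNReal.ofReal 3 by simp, ← ENNReal.ofReal_mul (by norm_num)] at key
    exact ENNReal.one_le_ofReal.1 key
  · intro v
    rw [hcard]
    refine natCast_le_mul_ofReal (le_trans ?_ hub_le)
    exact_mod_cast card_deg_ne_le hh θ₀ v
  · intro v i
    rw [hcard]
    refine natCast_le_mul_ofReal (le_trans ?_ (max_le hub_le cut_le))
    exact_mod_cast card_adj_ne_le he hh θ₀ v i
  · intro θ g hg
    refine (GraphInput.tsum_edgeAnswers_mul_le _ _ ?_ ?_ g hg).trans (add_le_add le_rfl ?_)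
    · rw [← Finset.card_pos, card_edgeFinset_instanceOf (Nat.zero_le N) hh]
      have := NeZero.pos N
      have := NeZero.pos m
      positivity
    · rw [card_edgeFinset_instanceOf (Nat.zero_le N) hh, card_edgeFinset_instanceOf he hh]
      simp
    · refine ENNReal.div_le_of_le_mul' (natCast_le_mul_ofReal ?_)
      rw [card_edgeFinset_instanceOf he hh]
      refine (Nat.cast_le.2 (card_edgeFinset_sdiff_le he hh θ₀)).trans ?_
      push_cast
      have : (0 : ℝ) ≤ (h : ℝ) * e * x := by positivity
      linarith

/-- Pascal's rule with `k.choose (p - 1)` estimated by `k.choose p`; the term `p` is needed because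
`k.choose p` may vanish. -/
theorem choose_succ_le (k : ℕ) {p : ℕ} (hp : p ≠ 0) :
    (k + 1).choose p ≤ (p + 1) * k.choose p + p := by
  obtain ⟨q, rfl⟩ := Nat.exists_eq_succ_of_ne_zero hp
  rw [Nat.succ_eq_add_one, Nat.choose_succ_succ']
  have hle : k.choose q ≤ (q + 1) * k.choose (q + 1) + (q + 1) := by
    rcases le_or_gt k q with hk | hk
    · have : k.choose q ≤ 1 := by
        rcases hk.eq_or_lt with rfl | hk
        · simp
        · simp [Nat.choose_eq_zero_of_lt hk]
      omega
    · have h1 := Nat.choose_succ_right_eq k q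
      have h2 : k.choose q * 1 ≤ k.choose q * (k - q) := Nat.mul_le_mul_left _ (by omega)
      linarith
  linarith

/-- If `(c - 1) s` is at most `l * d.choose p`, then it can be approximated by `l * e.choose p` with
`e ≤ d`, because `e.choose p` does not jump when `e` grows by one. -/
theorem exists_le_mul_choose {p l s d : ℕ} (hp : p ≠ 0) {c : ℝ} (hc : 1 < c) (hs : 0 < s)
    (hl : l ≤ s) (hd : (c - 1) * s ≤ (l : ℝ) * d.choose p) :
    ∃ e ≤ d, c * s ≤ (s : ℝ) + l * e.choose p ∧
      (s : ℝ) + l * e.choose p ≤ (p + 1) * c * s := by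
  classical
  have hex : ∃ e : ℕ, (c - 1) * s ≤ (l : ℝ) * e.choose p := ⟨d, hd⟩
  have hpos : 0 < (c - 1) * s := mul_pos (by linarith) (by exact_mod_cast hs)
  refine ⟨Nat.find hex, Nat.find_min' hex hd, by linarith [Nat.find_spec hex], ?_⟩
  obtain ⟨k, hk⟩ : ∃ k, Nat.find hex = k + 1 := by
    refine Nat.exists_eq_succ_of_ne_zero fun h0 => ?_
    have := Nat.find_spec hex
    rw [h0, Nat.choose_eq_zero_of_lt (Nat.pos_of_ne_zero hp)] at this
    simp only [Nat.cast_zero, mul_zero] at this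
    linarith
  have hlt : (l : ℝ) * k.choose p < (c - 1) * s := not_le.1 (Nat.find_min hex (by omega))
  have hch : ((k + 1).choose p : ℝ) ≤ (p + 1) * k.choose p + p := by
    exact_mod_cast choose_succ_le k hp
  have hl' : (l : ℝ) ≤ s := by exact_mod_cast hl
  rw [hk]
  calc (s : ℝ) + l * (k + 1).choose p ≤ s + l * ((p + 1) * k.choose p + p) := by gcongr
    _ = s + (p + 1) * (l * k.choose p) + p * l := by ring
    _ ≤ s + (p + 1) * ((c - 1) * s) + p * s := by gcongr
    _ = _ := by ring

/-- The instances need `e ≤ d₂` in place of `d₂`: the theorem does not bound `s₂` by a multiple of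
`s₁`, so that the degree `d₂` itself could put the number of stars above `hi`. -/
theorem requiresQueries_of_validParams {p n₁ d₁ n₂ d₂ : ℕ} (hp : p ≠ 0)
    (hv : ValidParams n₁ d₁ n₂ d₂) (hs₁ : 0 < s₁ p n₁ d₁) {c : ℝ} (hc : 1 < c)
    (hs₂ : c * (s₁ p n₁ d₁ : ℝ) ≤ (s₂ p n₁ d₁ n₂ d₂ : ℝ)) {a b lo hi : ℝ} (ha : 0 < a)
    (hb : b < c * a) (hlo : lo ≤ (s₁ p n₁ d₁ : ℝ) / 2)
    (hhi : (p + 1) * c * (s₁ p n₁ d₁ : ℝ) ≤ hi) :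
    RequiresQueries (n₁ + n₂) p lo hi a b (1 / 12 * (1 / ratio n₁ d₁ n₂ d₂)) := by
  obtain ⟨m, rfl⟩ : ∃ m, d₁ = 2 * m := hv.d₁_even.two_dvd
  obtain ⟨h, rfl⟩ : ∃ h, n₂ = 2 * h := hv.n₂_even.two_dvd
  have := hv.d₁_pos
  have := hv.n₂_pos
  have := hv.n₂_le
  have := hv.d₁_le
  have := hv.lt_n₁
  -- Half of the `n₁` vertices carry the circulant graph; the others stay isolated, so that the
  -- vertices whose degree is raised can hide among them.
  obtain ⟨N, M, hNM, hN₁, hN₂, hM₁⟩ : ∃ N M, N + M = n₁ + 2 * h ∧ n₁ ≤ 2 * N ∧ N ≤ n₁ ∧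
      n₁ ≤ 2 * M := ⟨(n₁ + 1) / 2, n₁ + 2 * h - (n₁ + 1) / 2, by omega⟩
  have : NeZero N := ⟨by omega⟩
  have : NeZero m := ⟨by omega⟩
  have : NeZero M := ⟨by omega⟩
  have φ : ZMod N ⊕ ZMod M ≃ Fin (n₁ + 2 * h) :=
    Fintype.equivFinOfCardEq (by simp [ZMod.card, hNM])
  have hN : 2 * m < N := by omega
  have hM : 2 * m ≤ M := by omega
  have hh : h ≤ m := by omega
  simp only [s₁, s₂] at hs₁ hs₂ hlo hhi
  have hch : 0 < (2 * m).choose p := Nat.pos_of_mul_pos_left hs₁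
  set s := N * (2 * m).choose p with hs_def
  have hs : 0 < s := Nat.mul_pos (by omega) hch
  have hs_le : (s : ℝ) ≤ (n₁ * (2 * m).choose p : ℕ) := by
    exact_mod_cast Nat.mul_le_mul_right _ hN₂
  have le_hs : ((n₁ * (2 * m).choose p : ℕ) : ℝ) ≤ 2 * s := by
    have := Nat.mul_le_mul_right ((2 * m).choose p) hN₁
    rw [mul_assoc] at this
    exact_mod_cast this
  have hls : 2 * h ≤ s := (show 2 * h ≤ N by omega).trans (Nat.le_mul_of_pos_right N hch)
  obtain ⟨e, hed, hce, hec⟩ := exists_le_mul_choose (d := d₂) hp hc hs hls (by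
    have : (c - 1) * (s : ℝ) ≤ (c - 1) * (n₁ * (2 * m).choose p : ℕ) :=
      mul_le_mul_of_nonneg_left hs_le (by linarith)
    push_cast at this hs₂ ⊢
    linarith)
  have he : e ≤ N := by omega
  have hS : ((s + 2 * h * e.choose p : ℕ) : ℝ) = (s : ℝ) + (2 * h : ℕ) * e.choose p := by
    push_cast; ring
  have hsR : (0 : ℝ) < s := by exact_mod_cast hs
  have hpc : 1 ≤ (p + 1) * c := by
    have : (0 : ℝ) ≤ p := p.cast_nonneg
    nlinarith
  have hhi' : (p + 1) * c * (s : ℝ) ≤ hi :=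
    (mul_le_mul_of_nonneg_left hs_le (by linarith)).trans hhi
  set r := ratio n₁ (2 * m) (2 * h) d₂ with hr_def
  have hn₁R : (0 : ℝ) < n₁ := by exact_mod_cast hv.n₁_pos
  have hmR : (0 : ℝ) < m := by exact_mod_cast NeZero.pos m
  have hhR : (0 : ℝ) < h := by exact_mod_cast (by omega : 0 < h)
  have hN₁R : (n₁ : ℝ) ≤ 2 * N := by exact_mod_cast hN₁
  have hM₁R : (n₁ : ℝ) ≤ 2 * M := by exact_mod_cast hM₁
  have hedR : (e : ℝ) ≤ d₂ := by exact_mod_cast hed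
  have hr : r * (m * n₁) = (2 * m + d₂) * h := by
    rw [hr_def, ratio]
    push_cast
    field_simp
  have hr₀ : 0 < r := by
    rw [hr_def, ratio]
    push_cast
    positivity
  intro R T hR
  have inst : ∀ e' θ, (s : ℝ) + (2 * h : ℕ) * e'.choose p ≤ (p + 1) * c * s → e' ≤ N →
      2 / 3 ≤ R.successProb (instanceOf φ hN hM h e' θ) p a b ∧
        R.MakesAtMost (instanceOf φ hN hM h e' θ) T := by
    intro e' θ hle he'
    have hcount := starCount_instanceOf (φ := φ) (hN := hN) (hM := hM) (θ := θ) hp he' hh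
    refine hR _ ?_ ?_ <;> rw [hcount, ← hs_def] <;> push_cast at hle ⊢
    · have : (0 : ℝ) ≤ 2 * h * e'.choose p := by positivity
      linarith
    · linarith
  have h₀ := inst 0 0 (by
    rw [Nat.choose_eq_zero_of_lt (Nat.pos_of_ne_zero hp)]
    simpa using le_mul_of_one_le_left hsR.le hpc) (Nat.zero_le N)
  -- The random edge query decides the constant `4`: the new edges are `2 * h * e` among at least
  -- `N * m`, where `N` is only about half of `n₁`. Then `1 ≤ 3 * T * (4 * r)`.
  have key := R.one_le_three_mul_of_instanceOf hp φ hN hM he hh (x := 4 * r) (by positivity) ?_ ?_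
    (a := a) (b := b) ?_ T 0 h₀.2 h₀.1 (fun θ => (inst e θ hec he).1)
  · rw [one_div_mul_one_div, div_le_iff₀ (by positivity)]
    linarith
  · have h1 : 2 * m * h ≤ r * (m * n₁) := by
      rw [hr]
      have : (0 : ℝ) ≤ d₂ * h := by positivity
      linarith
    have h2 : 2 * h ≤ r * n₁ := by
      refine le_of_mul_le_mul_left ?_ hmR
      linarith
    have := mul_le_mul_of_nonneg_left hM₁R hr₀.le
    linarith
  · have h1 : h * e ≤ r * (m * n₁) := by
      rw [hr]
      have : (h : ℝ) * e ≤ h * d₂ := by gcongr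
      have : (0 : ℝ) ≤ 2 * m * h := by positivity
      linarith
    have := mul_le_mul_of_nonneg_left hN₁R (mul_nonneg hr₀.le hmR.le)
    linarith
  · change b * (s : ℝ) < a * ((s + 2 * h * e.choose p : ℕ) : ℝ)
    rw [hS]
    calc b * (s : ℝ) < c * a * s := by gcongr
      _ = a * (c * s) := by ring
      _ ≤ _ := by gcongr

end StarCounting

theorem mainTheorem7 (p : ℕ) (hp : 2 ≤ p)
    (n₁ d₁ n₂ d₂ : ℕ → ℕ)
    (hparams : ∀ k, StarCounting.ValidParams (n₁ k) (d₁ k) (n₂ k) (d₂ k))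
    (f : ℕ → ℕ → ℝ) (hf : ∀ k, 0 < f (n₁ k + n₂ k) p)
    (hs₁ : (fun k => (StarCounting.s₁ p (n₁ k) (d₁ k) : ℝ))
      =Θ[atTop] (fun k => f (n₁ k + n₂ k) p))
    (c : ℝ) (hc : 1 < c)
    (hs₂ : ∀ k, c * (StarCounting.s₁ p (n₁ k) (d₁ k) : ℝ) ≤
      (StarCounting.s₂ p (n₁ k) (d₁ k) (n₂ k) (d₂ k) : ℝ)) :
    ∃ A B : ℝ, 0 < A ∧ A ≤ B ∧
      (∃ κ : ℝ, 0 < κ ∧ ∀ᶠ k in atTop, ∀ a b : ℝ, 0 < a → b < c * a →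
        StarCounting.RequiresQueries (n₁ k + n₂ k) p
          (A * f (n₁ k + n₂ k) p) (B * f (n₁ k + n₂ k) p) a b
          (κ * (1 / StarCounting.ratio (n₁ k) (d₁ k) (n₂ k) (d₂ k)))) ∧
      (∀ q : ℕ → ℝ,
        q =o[atTop] (fun k => 1 / StarCounting.ratio (n₁ k) (d₁ k) (n₂ k) (d₂ k)) →
        ∀ᶠ k in atTop, ∀ a b : ℝ, 0 < a → b < c * a →
          StarCounting.RequiresQueries (n₁ k + n₂ k) p
            (A * f (n₁ k + n₂ k) p) (B * f (n₁ k + n₂ k) p) a b (q k)) := by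
  obtain ⟨C₁, hC₁, hle₁⟩ := hs₁.1.exists_pos
  obtain ⟨C₂, hC₂, hle₂⟩ := hs₁.2.exists_pos
  have main : ∀ᶠ k in atTop, ∀ a b : ℝ, 0 < a → b < c * a →
      StarCounting.RequiresQueries (n₁ k + n₂ k) p (1 / (2 * C₂) * f (n₁ k + n₂ k) p)
        (max (1 / (2 * C₂)) ((p + 1) * c * C₁) * f (n₁ k + n₂ k) p) a b
        (1 / 12 * (1 / StarCounting.ratio (n₁ k) (d₁ k) (n₂ k) (d₂ k))) := by
    filter_upwards [hle₁.bound, hle₂.bound] with k h₁ h₂ a b ha hb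
    have hfk := hf k
    rw [Real.norm_of_nonneg (Nat.cast_nonneg _), Real.norm_of_nonneg hfk.le] at h₁ h₂
    have hpos : (0 : ℝ) < StarCounting.s₁ p (n₁ k) (d₁ k) :=
      pos_of_mul_pos_right (hfk.trans_le h₂) hC₂.le
    refine StarCounting.requiresQueries_of_validParams (by omega) (hparams k)
      (by exact_mod_cast hpos) hc (hs₂ k) ha hb ?_ ?_
    · rw [one_div_mul_eq_div, div_le_iff₀ (by positivity)]
      linarith
    · calc _ ≤ (p + 1) * c * (C₁ * f (n₁ k + n₂ k) p) := by gcongr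
        _ = (p + 1) * c * C₁ * f (n₁ k + n₂ k) p := by ring
        _ ≤ _ := by gcongr; exact le_max_right _ _
  refine ⟨1 / (2 * C₂), max (1 / (2 * C₂)) ((p + 1) * c * C₁), by positivity, le_max_left _ _,
    ⟨1 / 12, by norm_num, main⟩, fun q hq => ?_⟩
  filter_upwards [main, hq.bound (show (0 : ℝ) < 1 / 12 by norm_num)] with k hk hqk a b ha hb R T hR
  have hr : 0 ≤ 1 / StarCounting.ratio (n₁ k) (d₁ k) (n₂ k) (d₂ k) := by
    unfold StarCounting.ratio
    positivity
  rw [Real.norm_of_nonneg hr] at hqk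
  exact (le_abs_self _).trans (hqk.trans (hk a b ha hb R T hR))
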